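/- Let $k\ge 1$. A linear $k$-chord diagram of length $kn$ is a partition of $kn$ linearly arranged vertices $1,2,\dots,kn$ into $n$ blocks of size $k$, called $k$-chords; a $k$-chord is short if its $k$ vertices are consecutive. For $n\ge 0$ and $\ell\in\mathbb{Z}$ let $d_{n,\ell}$ be the number of linear $k$-chord diagrams of length $kn$ with exactly $\ell$ short chords (so $d_{0,0}=1$ and $d_{n,-1}=0$). Then for all integers $n\ge 0$ and $\ell\ge 0$, $$d_{n+1,\ell} = d_{n,\ell-1} + d_{n,\ell}\sum_{h=1}^{k-1}\binom{kn-(k-1)\ell+k-h-1}{k-h} + \sum_{p=1}^{k-1} C_{n,\ell,p,k}\,d_{n,\ell+p},$$ where, for $1\le p\le k-1$, $$C_{n,\ell,p,k}=\sum_{h=1}^{k-p}\ \sum_{f=0}^{k-p-h}\binom{kn-(k-1)(\ell+p)+f-1}{f}\,[x^{k-h-f}y^p]\left(1+y-y(1-x)^{1-k}\right)^{-\ell-1}.$$ Here $\binom{a}{b}=a(a-1)\cdots(a-b+1)/b!$ for $a\in\mathbb{Z}$ and $b\ge 0$, and $[x^iy^j]F$ denotes the coefficient of $x^iy^j$ in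 the formal power series $F\in\mathbb{Q}[[x,y]]$. -/

import Mathlib

namespace KChord

/-- A linear `k`-chord diagram of length `k * n`: a partition of the `k * n` linearly arranged
vertices into blocks (the `k`-chords), each consisting of exactly `k` vertices. -/
def IsDiagram (k n : ℕ) (P : Finpartition (Finset.univ : Finset (Fin (k * n)))) : Prop :=
  ∀ c ∈ P.parts, c.card = k

/-- A `k`-chord is short if its vertices are adjacent, i.e. it consists of the `k` consecutive
vertices `a, a + 1, …, a + k - 1` for some `a`. -/
def IsShort {k n : ℕ} (c : Finset (Fin (k * n))) : Prop :=
  ∃ a : ℕ, ∀ v : Fin (k * n), v ∈ c ↔ a ≤ (v : ℕ) ∧ (v : ℕ) < a + k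

/-- The number of short chords of a diagram. -/
noncomputable def numShort {k n : ℕ}
    (P : Finpartition (Finset.univ : Finset (Fin (k * n)))) : ℕ :=
  {c : Finset (Fin (k * n)) | c ∈ P.parts ∧ IsShort c}.ncard

/-- `d k n ℓ` is the number of linear `k`-chord diagrams of length `k * n` with exactly `ℓ` short
chords. The index `ℓ` is an integer, so that the count is `0` for `ℓ = -1`. -/
noncomputable def d (k n : ℕ) (ℓ : ℤ) : ℕ :=
  {P : Finpartition (Finset.univ : Finset (Fin (k * n))) |
    IsDiagram k n P ∧ (numShort P : ℤ) = ℓ}.ncard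

/-- The variable `x` of the ring `ℚ⟦x, y⟧`. -/
noncomputable def x : MvPowerSeries (Fin 2) ℚ := MvPowerSeries.X 0

/-- The variable `y` of the ring `ℚ⟦x, y⟧`. -/
noncomputable def y : MvPowerSeries (Fin 2) ℚ := MvPowerSeries.X 1

/-- The formal power series `(1 + y - y (1 - x) ^ (1 - k)) ^ (-ℓ - 1)` for `1 ≤ k`; both inverses
are inverses of power series with constant coefficient `1`. -/
noncomputable def series (k ℓ : ℕ) : MvPowerSeries (Fin 2) ℚ :=
  ((1 + y - y * ((1 - x) ^ (k - 1))⁻¹) ^ (ℓ + 1))⁻¹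

/-- Extraction of the coefficient of `x ^ i * y ^ j`. -/
noncomputable def coeffXY (i j : ℕ) (F : MvPowerSeries (Fin 2) ℚ) : ℚ :=
  MvPowerSeries.coeff (Finsupp.single 0 i + Finsupp.single 1 j) F

/-- The coefficient `C_{n,ℓ,p,k}`, for `1 ≤ p ≤ k - 1`. `Ring.choose` is the binomial coefficient
with an integer upper argument. -/
noncomputable def C (n ℓ p k : ℕ) : ℚ :=
  ∑ h ∈ Finset.Icc 1 (k - p), ∑ f ∈ Finset.Icc 0 (k - p - h),
    ((Ring.choose ((k : ℤ) * n - ((k : ℤ) - 1) * (ℓ + p) + f - 1) f : ℤ) : ℚ) *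
      coeffXY (k - h - f) p (series k ℓ)

end KChord

/-!
Delete the `k`-chord through the last vertex of a diagram on `k (n + 1)` vertices. What remains is a
diagram on `N = k n` vertices, and the deleted chord is recovered from the vector `g` whose entry
`g i` is the number of its vertices lying immediately before the old vertex `i`, with `g N ≥ 1` for
the vertices after all old ones. Every such vector with entry sum `k` occurs
(`insertChord_inj`, `exists_insertChord_eq`). An old short chord on `a, …, a + k - 1` stays short if
and only if `g` vanishes on `a + 1, …, a + k - 1`, no old chord becomes short, and the new chord is
short if and only if `g N = k` (`card_shortStarts_insertChord`).

The insertions with `g N = k` turn `ℓ - 1` short chords into `ℓ` and give the term `d_{n, ℓ - 1}`.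
For `g N = h < k` and a diagram with `m` short chords, the number of vectors for which exactly `ℓ`
short chords survive is
`binom m ℓ * [x ^ (k - h)] (1 - x) ^ (-(N - (k - 1) m)) * ((1 - x) ^ (1 - k) - 1) ^ (m - ℓ)`:
a surviving short chord has no new vertex in its `k - 1` inner gaps, a broken one has at least one,
and the remaining `N - (k - 1) m` gaps are free (`card_filter_card_empty_eq`). With `m = ℓ + p`, the
factor `binom (ℓ + p) ℓ * ((1 - x) ^ (1 - k) - 1) ^ p` is the coefficient of `y ^ p` in
`(1 + y - y (1 - x) ^ (1 - k)) ^ (-ℓ - 1)` (`coeffXY_series`), and expanding the product gives the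
constants of the recurrence (`C_eq`). The inverse powers of `1 - x` are `PowerSeries.invOneSubPow`.
-/

namespace KChord

open Finset PowerSeries

/-! ### Counting vectors by the blocks on which they vanish -/

theorem coeff_invOneSubPow (d n : ℕ) :
    coeff n (invOneSubPow ℚ d : ℚ⟦X⟧) = d.multichoose n := by
  cases d with
  | zero =>
    rw [invOneSubPow_zero, Units.val_one, coeff_one]
    cases n <;> simp
  | succ d =>
    rw [invOneSubPow_val_succ_eq_mk_add_choose, coeff_mk, Nat.multichoose_eq]
    congr 1
    rw [show d + 1 + n - 1 = d + n by omega, Nat.choose_symm_add]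

theorem card_piAntidiag (s : Finset ℕ) (j : ℕ) :
    (#(piAntidiag s j) : ℚ) = coeff j (invOneSubPow ℚ #s : ℚ⟦X⟧) := by
  induction s using Finset.cons_induction generalizing j with
  | empty =>
    rw [card_empty, invOneSubPow_zero, Units.val_one, coeff_one, piAntidiag_empty]
    split <;> simp
  | cons i s hi ih =>
    rw [piAntidiag_cons, card_disjiUnion, card_cons, add_comm, invOneSubPow_add, Units.val_mul,
      coeff_mul]
    push_cast
    refine sum_congr rfl fun p _ => ?_
    rw [card_map, ih, coeff_invOneSubPow 1]
    simp

theorem filter_piAntidiag_eq_zero (s t : Finset ℕ) (j : ℕ) :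
    {g ∈ piAntidiag s j | ∀ v ∈ t, g v = 0} = piAntidiag (s \ t) j := by
  ext g
  simp only [mem_filter, mem_piAntidiag, mem_sdiff]
  constructor
  · rintro ⟨⟨h1, h2⟩, h3⟩
    refine ⟨?_, fun i hi => ⟨h2 i hi, fun h => hi (h3 i h)⟩⟩
    rw [← h1]
    refine sum_subset sdiff_subset fun v hv hv' => h3 v ?_
    simpa [hv] using hv'
  · rintro ⟨h1, h2⟩
    have h3 : ∀ v ∈ t, g v = 0 := fun v hv => by
      by_contra h
      exact (h2 v h).2 hv
    refine ⟨⟨?_, fun i hi => (h2 i hi).1⟩, h3⟩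
    rw [← h1]
    refine (sum_subset sdiff_subset fun v hv hv' => h3 v ?_).symm
    simpa [hv] using hv'

/-- The number of vectors with entry sum `j` supported in `s` that are nonzero somewhere on each of
the disjoint `r`-element sets `B i`, `i ∈ H`, where `q` coordinates of `s` lie in none of them. By
induction on `H`: the vectors nonzero somewhere on `B a` are all vectors minus those vanishing on
`B a`, that is, supported in `s \ B a`. -/
theorem card_filter_forall_hit {ι : Type*} (B : ι → Finset ℕ) (r j : ℕ) (H : Finset ι)
    (hr : ∀ i ∈ H, #(B i) = r) (hd : (H : Set ι).PairwiseDisjoint B)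
    (s : Finset ℕ) (hs : ∀ i ∈ H, B i ⊆ s) (q : ℕ) (hq : #s = q + r * #H) :
    (#{g ∈ piAntidiag s j | ∀ i ∈ H, ∃ v ∈ B i, g v ≠ 0} : ℚ) =
      coeff j ((invOneSubPow ℚ q : ℚ⟦X⟧) * ((invOneSubPow ℚ r : ℚ⟦X⟧) - 1) ^ #H) := by
  classical
  induction H using Finset.cons_induction generalizing s q with
  | empty => simp [card_piAntidiag, hq]
  | cons a H ha ih =>
    rw [card_cons] at hq ⊢
    have hr' : ∀ i ∈ H, #(B i) = r := fun i hi => hr i (mem_cons_of_mem hi)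
    have hd' : (H : Set ι).PairwiseDisjoint B :=
      hd.subset fun i hi => mem_coe.2 (mem_cons_of_mem hi)
    have h1 := ih hr' hd' s (fun i hi => hs i (mem_cons_of_mem hi)) (q + r)
      (by rw [hq]; ring)
    have hsub : ∀ i ∈ H, B i ⊆ s \ B a := fun i hi => by
      rw [subset_sdiff]
      exact ⟨hs i (mem_cons_of_mem hi),
        hd (by simp [hi]) (by simp) (by rintro rfl; exact ha hi)⟩
    have hc : #(s \ B a) = q + r * #H := by
      rw [card_sdiff_of_subset (hs a (mem_cons_self _ _)), hr a (mem_cons_self _ _), hq, mul_add]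
      omega
    have h2 := ih hr' hd' (s \ B a) hsub q hc
    rw [← filter_piAntidiag_eq_zero, filter_filter] at h2
    have h3 := card_filter_add_card_filter_not
      (s := {g ∈ piAntidiag s j | ∀ i ∈ H, ∃ v ∈ B i, g v ≠ 0}) (fun g => ∀ v ∈ B a, g v = 0)
    rw [filter_filter, filter_filter] at h3
    have e1 : {g ∈ piAntidiag s j | (∀ i ∈ H, ∃ v ∈ B i, g v ≠ 0) ∧ ∀ v ∈ B a, g v = 0} =
        {g ∈ piAntidiag s j | (∀ v ∈ B a, g v = 0) ∧ ∀ i ∈ H, ∃ v ∈ B i, g v ≠ 0} :=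
      filter_congr fun g _ => and_comm
    have e2 : {g ∈ piAntidiag s j | (∀ i ∈ H, ∃ v ∈ B i, g v ≠ 0) ∧ ¬ ∀ v ∈ B a, g v = 0} =
        {g ∈ piAntidiag s j | ∀ i ∈ cons a H ha, ∃ v ∈ B i, g v ≠ 0} :=
      filter_congr fun g _ => by
        rw [forall_mem_cons, and_comm]
        push Not
        rfl
    rw [e1, e2] at h3
    have h4 : (#{g ∈ piAntidiag s j | ∀ i ∈ cons a H ha, ∃ v ∈ B i, g v ≠ 0} : ℚ) =
        coeff j ((invOneSubPow ℚ (q + r) : ℚ⟦X⟧) * ((invOneSubPow ℚ r : ℚ⟦X⟧) - 1) ^ #H) -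
        coeff j ((invOneSubPow ℚ q : ℚ⟦X⟧) * ((invOneSubPow ℚ r : ℚ⟦X⟧) - 1) ^ #H) := by
      rw [← h1, ← h2, ← h3]
      push_cast
      ring
    rw [h4, ← map_sub, invOneSubPow_add, Units.val_mul]
    congr 1
    ring

/-- The number of vectors with entry sum `j` supported in `s` that vanish on exactly `l` of the
disjoint `r`-element sets `B i`, `i ∈ I`. Once the `l` sets are chosen, their union can be removed
from `s`, and the vector has to be nonzero somewhere on each of the others. -/
theorem card_filter_card_empty_eq {ι : Type*} (B : ι → Finset ℕ) (r j l : ℕ) (I : Finset ι)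
    (hr : ∀ i ∈ I, #(B i) = r) (hd : (I : Set ι).PairwiseDisjoint B)
    (s : Finset ℕ) (hs : ∀ i ∈ I, B i ⊆ s) (q : ℕ) (hq : #s = q + r * #I) :
    (#{g ∈ piAntidiag s j | #{i ∈ I | ∀ v ∈ B i, g v = 0} = l} : ℚ) =
      (#I).choose l *
        coeff j ((invOneSubPow ℚ q : ℚ⟦X⟧) * ((invOneSubPow ℚ r : ℚ⟦X⟧) - 1) ^ (#I - l)) := by
  classical
  have hmap : ∀ g ∈ ({g ∈ piAntidiag s j | #{i ∈ I | ∀ v ∈ B i, g v = 0} = l} : Finset (ℕ → ℕ)),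
      ({i ∈ I | ∀ v ∈ B i, g v = 0} : Finset ι) ∈ powersetCard l I := fun g hg => by
    rw [mem_powersetCard]
    exact ⟨filter_subset _ _, (mem_filter.1 hg).2⟩
  rw [card_eq_sum_card_fiberwise hmap]
  push_cast
  rw [← card_powersetCard, ← nsmul_eq_mul, ← sum_const]
  refine sum_congr rfl fun T hT => ?_
  obtain ⟨hTI, hTl⟩ := mem_powersetCard.1 hT
  have hcard : #(I \ T) = #I - l := by rw [card_sdiff_of_subset hTI, hTl]
  have hsub : T.biUnion B ⊆ s := biUnion_subset.2 fun i hi => hs i (hTI hi)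
  have hq' : #(s \ T.biUnion B) = q + r * #(I \ T) := by
    rw [card_sdiff_of_subset hsub, card_biUnion, sum_congr rfl fun i hi => hr i (hTI hi),
      sum_const, smul_eq_mul, hq, ← card_sdiff_add_card_eq_card hTI, mul_add, mul_comm #T]
    · omega
    · exact fun i hi i' hi' h => hd (hTI hi) (hTI hi') h
  have hsub' : ∀ i ∈ I \ T, B i ⊆ s \ T.biUnion B := fun i hi => by
    rw [mem_sdiff] at hi
    rw [subset_sdiff, disjoint_biUnion_right]
    refine ⟨hs i hi.1, fun i' hi' => hd hi.1 (hTI hi') ?_⟩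
    rintro rfl
    exact hi.2 hi'
  have key := card_filter_forall_hit B r j (I \ T) (fun i hi => hr i (sdiff_subset hi))
    (hd.subset (by simp)) _ hsub' q hq'
  rw [hcard] at key
  rw [← key, ← filter_piAntidiag_eq_zero, filter_filter, filter_filter]
  congr 2
  refine filter_congr fun g _ => ?_
  constructor
  · rintro ⟨-, rfl⟩
    refine ⟨fun v hv => ?_, fun i hi => ?_⟩
    · obtain ⟨i, hi, hv⟩ := mem_biUnion.1 hv
      exact (mem_filter.1 hi).2 v hv
    · by_contra! h
      rw [mem_sdiff, mem_filter] at hi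
      exact hi.2 ⟨hi.1, h⟩
  · rintro ⟨h1, h2⟩
    have : ({i ∈ I | ∀ v ∈ B i, g v = 0} : Finset ι) = T := by
      ext i
      rw [mem_filter]
      refine ⟨fun ⟨hi, h⟩ => ?_, fun hi => ⟨hTI hi, fun v hv => h1 v (mem_biUnion.2 ⟨i, hi, hv⟩)⟩⟩
      by_contra hiT
      obtain ⟨v, hv, h'⟩ := h2 i (mem_sdiff.2 ⟨hi, hiT⟩)
      exact h' (h v hv)
    exact ⟨by rw [this, hTl], this⟩

/-! ### The bivariate power series -/

/-- The ring homomorphism `ℚ⟦x⟧⟦y⟧ → ℚ⟦x, y⟧`: the outer variable goes to `y` and the inner one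
to `x`. -/
noncomputable def toXY : ℚ⟦X⟧⟦X⟧ →+* MvPowerSeries (Fin 2) ℚ where
  toFun F := fun m => coeff (m 0) (coeff (m 1) F)
  map_one' := by
    ext m
    rw [MvPowerSeries.coeff_one]
    change coeff (m 0) (coeff (m 1) (1 : ℚ⟦X⟧⟦X⟧)) = _
    have : m = 0 ↔ m 1 = 0 ∧ m 0 = 0 := by
      rw [Finsupp.ext_iff, Fin.forall_fin_two]
      simp [and_comm]
    rw [coeff_one]
    by_cases h : m 1 = 0 <;> simp [h, this, coeff_one]
  map_zero' := by
    ext m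
    change coeff (m 0) (coeff (m 1) (0 : ℚ⟦X⟧⟦X⟧)) = _
    simp
  map_add' F G := by
    ext m
    change coeff (m 0) (coeff (m 1) (F + G)) = coeff (m 0) (coeff (m 1) F) + coeff (m 0) (coeff (m 1) G)
    simp
  map_mul' F G := by
    ext m
    refine Eq.trans ?_ (MvPowerSeries.coeff_mul _ _ _).symm
    change coeff (m 0) (coeff (m 1) (F * G)) = ∑ p ∈ antidiagonal m,
      coeff (p.1 0) (coeff (p.1 1) F) * coeff (p.2 0) (coeff (p.2 1) G)
    simp only [coeff_mul, map_sum]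
    rw [← sum_product']
    refine (sum_bij' (fun (p : (Fin 2 →₀ ℕ) × (Fin 2 →₀ ℕ)) _ => ((p.1 1, p.2 1), (p.1 0, p.2 0)))
      (fun p _ => (Finsupp.single 0 p.2.1 + Finsupp.single 1 p.1.1,
        Finsupp.single 0 p.2.2 + Finsupp.single 1 p.1.2)) ?_ ?_ ?_ ?_ ?_).symm
    · rintro ⟨a, b⟩ h
      rw [HasAntidiagonal.mem_antidiagonal] at h
      subst h
      simp
    · rintro ⟨⟨a, b⟩, c, d⟩ h
      simp only [mem_product, HasAntidiagonal.mem_antidiagonal] at h ⊢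
      ext i
      fin_cases i <;> simp [h.1, h.2]
    · rintro ⟨a, b⟩ h
      refine Prod.ext ?_ ?_ <;> ext i <;> fin_cases i <;> simp
    · rintro ⟨⟨a, b⟩, c, d⟩ h
      simp
    · rintro ⟨a, b⟩ h
      rfl

theorem coeffXY_toXY (i j : ℕ) (F : ℚ⟦X⟧⟦X⟧) : coeffXY i j (toXY F) = coeff i (coeff j F) := by
  change coeff ((Finsupp.single 0 i + Finsupp.single 1 j : Fin 2 →₀ ℕ) 0)
    (coeff ((Finsupp.single 0 i + Finsupp.single 1 j : Fin 2 →₀ ℕ) 1) F) = _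
  simp

theorem toXY_X : toXY X = y := by
  ext m
  change coeff (m 0) (coeff (m 1) (X : ℚ⟦X⟧⟦X⟧)) = _
  have : m = Finsupp.single 1 1 ↔ m 1 = 1 ∧ m 0 = 0 := by
    rw [Finsupp.ext_iff, Fin.forall_fin_two]
    simp [and_comm]
  rw [y, MvPowerSeries.coeff_X, coeff_X]
  by_cases h : m 1 = 1 <;> simp [h, this, coeff_one]

theorem toXY_C_X : toXY (PowerSeries.C X) = x := by
  ext m
  change coeff (m 0) (coeff (m 1) (PowerSeries.C X : ℚ⟦X⟧⟦X⟧)) = _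
  have : m = Finsupp.single 0 1 ↔ m 1 = 0 ∧ m 0 = 1 := by
    rw [Finsupp.ext_iff, Fin.forall_fin_two]
    simp [and_comm]
  rw [x, MvPowerSeries.coeff_X, coeff_C]
  by_cases h : m 1 = 0 <;> simp [h, this, coeff_X]

theorem series_eq (k l : ℕ) :
    series k l = toXY (rescale ((invOneSubPow ℚ (k - 1) : ℚ⟦X⟧) - 1)
      (invOneSubPow ℚ⟦X⟧ (l + 1) : ℚ⟦X⟧⟦X⟧)) := by
  have hu : ((1 - x) ^ (k - 1))⁻¹ = toXY (PowerSeries.C (invOneSubPow ℚ (k - 1) : ℚ⟦X⟧)) := by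
    rw [MvPowerSeries.inv_eq_iff_mul_eq_one (by simp [x]), ← toXY_C_X, ← map_one toXY,
      ← map_sub, ← map_pow, ← map_mul, ← map_one PowerSeries.C, ← map_sub, ← map_pow, ← map_mul,
      ← invOneSubPow_inv_eq_one_sub_pow, Units.inv_eq_val_inv, Units.mul_inv]
  rw [series, hu, MvPowerSeries.inv_eq_iff_mul_eq_one (by simp [y]), ← toXY_X]
  have h1 : (1 + toXY X - toXY X * toXY (PowerSeries.C (invOneSubPow ℚ (k - 1) : ℚ⟦X⟧))) =
      toXY (rescale ((invOneSubPow ℚ (k - 1) : ℚ⟦X⟧) - 1) (1 - X)) := by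
    rw [map_sub (rescale _), map_one (rescale _), rescale_X, ← map_mul, ← map_one toXY, ← map_add,
      ← map_sub]
    congr 1
    rw [map_sub PowerSeries.C, map_one PowerSeries.C]
    ring
  rw [h1, ← map_pow, ← map_pow, ← map_mul, ← map_mul, ← invOneSubPow_inv_eq_one_sub_pow,
    Units.inv_eq_val_inv, Units.mul_inv, map_one, map_one]

/-- The series is `(1 - y w) ^ (-l - 1)` with `w = (1 - x) ^ (1 - k) - 1`. -/
theorem coeffXY_series (k l i p : ℕ) :
    coeffXY i p (series k l) =
      (l + p).choose l * coeff i (((invOneSubPow ℚ (k - 1) : ℚ⟦X⟧) - 1) ^ p) := by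
  rw [series_eq, coeffXY_toXY, coeff_rescale, invOneSubPow_val_succ_eq_mk_add_choose, coeff_mk,
    mul_comm, ← nsmul_eq_mul, map_nsmul, nsmul_eq_mul]

/-- For `N = f = 0` the upper argument is `-1`, and both sides are `1`. -/
theorem ringChoose_eq (N f : ℕ) :
    ((Ring.choose ((N : ℤ) + f - 1) f : ℤ) : ℚ) = coeff f (invOneSubPow ℚ N : ℚ⟦X⟧) := by
  rw [← Ring.multichoose_eq, coeff_invOneSubPow, ← Int.cast_natCast (Nat.multichoose N f)]
  congr 1
  cases N with
  | zero => cases f <;> simp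
  | succ N =>
    rw [Ring.multichoose_eq, Nat.multichoose_eq, ← Ring.choose_natCast]
    congr 1
    push_cast [show N + 1 + f - 1 = N + f by omega]
    ring

/-- The base is divisible by `X`. -/
theorem coeff_pow_eq_zero_of_lt (k p i : ℕ) (h : i < p) :
    coeff i (((invOneSubPow ℚ k : ℚ⟦X⟧) - 1) ^ p) = 0 := by
  refine X_pow_dvd_iff.1 (pow_dvd_pow_of_dvd (X_dvd_iff.2 ?_) p) i h
  rw [map_sub, ← coeff_zero_eq_constantCoeff_apply, coeff_invOneSubPow]
  simp

/-- The inner sum over `f` is the coefficient of a product of two power series, with only the terms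
that vanish for degree reasons left out, and likewise for the outer sum over `h`. -/
theorem C_eq (n l p k N : ℕ) (hk : 1 ≤ k) (hp : 1 ≤ p) (hN : k * n = N + (k - 1) * (l + p)) :
    C n l p k = (l + p).choose l * ∑ h ∈ Icc 1 (k - 1), coeff (k - h)
      ((invOneSubPow ℚ N : ℚ⟦X⟧) * ((invOneSubPow ℚ (k - 1) : ℚ⟦X⟧) - 1) ^ p) := by
  have hN' : (k : ℤ) * n - ((k : ℤ) - 1) * (l + p) = N := by
    zify [hk] at hN
    linarith
  have hsub : Icc 1 (k - p) ⊆ Icc 1 (k - 1) := Icc_subset_Icc_right (by omega)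
  rw [C, hN', mul_sum]
  rw [← sum_subset hsub]
  · refine sum_congr rfl fun h hh => ?_
    rw [mem_Icc] at hh
    rw [coeff_mul, Nat.sum_antidiagonal_eq_sum_range_succ_mk, mul_sum]
    refine sum_subset_zero_on_sdiff (fun f hf => ?_) (fun f hf => ?_) fun f hf => ?_
    · simp only [mem_Icc, mem_range] at hf ⊢
      omega
    · simp only [mem_sdiff, mem_Icc, mem_range] at hf
      rw [coeff_pow_eq_zero_of_lt _ _ _ (by omega)]
      simp
    · rw [ringChoose_eq, coeffXY_series]
      ring
  · intro h h1 h2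
    simp only [mem_Icc] at h1 h2
    rw [coeff_mul, sum_eq_zero, mul_zero]
    intro q hq
    rw [HasAntidiagonal.mem_antidiagonal] at hq
    rw [coeff_pow_eq_zero_of_lt _ _ _ (by omega), mul_zero]

/-! ### Inserting a chord through the last vertex -/

/-- `Q` is a set of `k`-element sets of natural numbers that partition `{0, …, N - 1}`. This is the
form in which diagrams are handled: it allows vertices to be renumbered without casts between the
types `Fin N`. -/
structure IsChordSet (k N : ℕ) (Q : Finset (Finset ℕ)) : Prop where
  card_eq : ∀ c ∈ Q, #c = k
  lt_iff : ∀ v, v < N ↔ ∃ c ∈ Q, v ∈ c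
  eq_of_mem : ∀ c ∈ Q, ∀ c' ∈ Q, ∀ v, v ∈ c → v ∈ c' → c = c'

open scoped Classical in
/-- The finset of all partitions of `{0, …, N - 1}` into `k`-element sets. -/
noncomputable def chordSets (k N : ℕ) : Finset (Finset (Finset ℕ)) :=
  {Q ∈ (range N).powerset.powerset | IsChordSet k N Q}

open scoped Classical in
theorem mem_chordSets {k N : ℕ} {Q : Finset (Finset ℕ)} :
    Q ∈ chordSets k N ↔ IsChordSet k N Q := by
  refine mem_filter.trans (and_iff_right_iff_imp.2 fun h => ?_)
  rw [mem_powerset]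
  intro c hc
  rw [mem_powerset]
  intro v hv
  exact mem_range.2 ((h.lt_iff v).2 ⟨c, hc, hv⟩)

/-- The renumbering of the old vertices when `g j` new vertices are inserted immediately before the
old vertex `j`, for each `j`. -/
def shift (g : ℕ → ℕ) (i : ℕ) : ℕ := i + ∑ j ∈ range (i + 1), g j

theorem shift_succ (g : ℕ → ℕ) (i : ℕ) : shift g (i + 1) = shift g i + 1 + g (i + 1) := by
  rw [shift, shift, sum_range_succ _ (i + 1)]
  ring

theorem shift_strictMono (g : ℕ → ℕ) : StrictMono (shift g) :=
  strictMono_nat_of_lt_succ fun i => by rw [shift_succ]; omega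

theorem shift_injective : Function.Injective shift := fun g g' h => by
  funext i
  cases i with
  | zero => simpa [shift] using congrFun h 0
  | succ i =>
    have h1 := congrFun h (i + 1)
    have h2 := congrFun h i
    rw [shift_succ, shift_succ] at h1
    omega

theorem exists_shift_eq {e : ℕ → ℕ} (he : StrictMono e) : ∃ g, shift g = e := by
  refine ⟨fun i => Nat.casesOn i (e 0) fun i => e (i + 1) - e i - 1, ?_⟩
  funext i
  induction i with
  | zero => simp [shift]
  | succ i ih =>
    have := he (Nat.lt_succ_self i)
    rw [shift_succ, ih]
    change e i < e (i + 1) at this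
    dsimp only
    omega

/-- The vectors that record how the `k` vertices of a new chord ending at the last position are
inserted among `N` old vertices: `g i` of them immediately before the old vertex `i < N`, and
`g N ≥ 1` of them after all old vertices. -/
def gapVectors (k N : ℕ) : Finset (ℕ → ℕ) := {g ∈ piAntidiag (range (N + 1)) k | 1 ≤ g N}

/-- The positions of the inserted vertices, i.e. those not taken by the `N` old vertices. -/
def newChord (k N : ℕ) (g : ℕ → ℕ) : Finset ℕ := range (N + k) \ (range N).image (shift g)

/-- The chord set obtained from `Q` by inserting a new chord according to `g`. -/
def insertChord (k N : ℕ) (Q : Finset (Finset ℕ)) (g : ℕ → ℕ) : Finset (Finset ℕ) :=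
  insert (newChord k N g) (Q.image fun c => c.image (shift g))

section

variable {k N : ℕ} {g : ℕ → ℕ}

theorem mem_gapVectors : g ∈ gapVectors k N ↔
    (∑ i ∈ range (N + 1), g i = k ∧ ∀ i, g i ≠ 0 → i < N + 1) ∧ 1 ≤ g N := by
  simp [gapVectors]

theorem shift_of_ge (hg : g ∈ gapVectors k N) {i : ℕ} (hi : N ≤ i) : shift g i = i + k := by
  rw [mem_gapVectors] at hg
  rw [shift, ← hg.1.1]
  congr 1
  refine (sum_subset (range_subset_range.2 (by omega)) fun j _ hj => ?_).symm
  by_contra h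
  exact hj (mem_range.2 (hg.1.2 j h))

theorem shift_lt (hg : g ∈ gapVectors k N) {i : ℕ} (hi : i < N) : shift g i + 1 < N + k := by
  have h1 : shift g (N - 1 + 1) = N + k := by
    rw [Nat.sub_add_cancel (by omega)]
    exact shift_of_ge hg le_rfl
  rw [shift_succ, Nat.sub_add_cancel (by omega)] at h1
  have h2 := (mem_gapVectors.1 hg).2
  have h3 := (shift_strictMono g).monotone (show i ≤ N - 1 by omega)
  omega

theorem shift_notMem_newChord (k N : ℕ) (g : ℕ → ℕ) {i : ℕ} (hi : i < N) :
    shift g i ∉ newChord k N g := fun h =>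
  (mem_sdiff.1 h).2 (mem_image_of_mem _ (mem_range.2 hi))

theorem lt_iff_mem_newChord_or (hg : g ∈ gapVectors k N) (v : ℕ) :
    v < N + k ↔ v ∈ newChord k N g ∨ ∃ i < N, shift g i = v := by
  rw [newChord, mem_sdiff, mem_image, mem_range]
  simp only [mem_range]
  refine ⟨fun h => ?_, ?_⟩
  · by_cases h' : ∃ i < N, shift g i = v
    · exact Or.inr h'
    · exact Or.inl ⟨h, h'⟩
  · rintro (h | ⟨i, hi, rfl⟩)
    · exact h.1
    · have := shift_lt hg hi
      omega

theorem card_newChord (hg : g ∈ gapVectors k N) : #(newChord k N g) = k := by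
  rw [newChord, card_sdiff_of_subset, card_image_of_injective _ (shift_strictMono g).injective,
    card_range, card_range, Nat.add_sub_cancel_left]
  intro v hv
  obtain ⟨i, hi, rfl⟩ := mem_image.1 hv
  have := shift_lt hg (mem_range.1 hi)
  exact mem_range.2 (by omega)

theorem last_mem_newChord (hk : 1 ≤ k) (hg : g ∈ gapVectors k N) : N + k - 1 ∈ newChord k N g := by
  rcases (lt_iff_mem_newChord_or hg (N + k - 1)).1 (by omega) with h | ⟨i, hi, h⟩
  · exact h
  · have := shift_lt hg hi
    omega

theorem last_notMem_image (hg : g ∈ gapVectors k N) {c : Finset ℕ} (hc : ∀ v ∈ c, v < N) :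
    N + k - 1 ∉ c.image (shift g) := fun h => by
  obtain ⟨i, hi, h⟩ := mem_image.1 h
  have := shift_lt hg (hc i hi)
  omega

theorem IsChordSet.lt {Q : Finset (Finset ℕ)} (hQ : IsChordSet k N Q) {c : Finset ℕ} (hc : c ∈ Q)
    {v : ℕ} (hv : v ∈ c) : v < N := (hQ.lt_iff v).2 ⟨c, hc, hv⟩

theorem isChordSet_insertChord {Q : Finset (Finset ℕ)} (hQ : IsChordSet k N Q)
    (hg : g ∈ gapVectors k N) : IsChordSet k (N + k) (insertChord k N Q g) := by
  have hinj := (shift_strictMono g).injective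
  refine ⟨fun c hc => ?_, fun v => ?_, fun c hc c' hc' v hv hv' => ?_⟩
  · rcases mem_insert.1 hc with rfl | hc
    · exact card_newChord hg
    · obtain ⟨d, hd, rfl⟩ := mem_image.1 hc
      rw [card_image_of_injective _ hinj, hQ.card_eq d hd]
  · rw [lt_iff_mem_newChord_or hg, insertChord, exists_mem_insert, exists_mem_image]
    refine or_congr Iff.rfl ⟨?_, ?_⟩
    · rintro ⟨i, hi, rfl⟩
      obtain ⟨c, hc, hic⟩ := (hQ.lt_iff i).1 hi
      exact ⟨c, hc, mem_image_of_mem _ hic⟩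
    · rintro ⟨c, hc, hv⟩
      obtain ⟨i, hi, rfl⟩ := mem_image.1 hv
      exact ⟨i, hQ.lt hc hi, rfl⟩
  · rcases mem_insert.1 hc with rfl | hc <;> rcases mem_insert.1 hc' with rfl | hc'
    · rfl
    · obtain ⟨d', hd', rfl⟩ := mem_image.1 hc'
      obtain ⟨i, hi, rfl⟩ := mem_image.1 hv'
      exact absurd hv (shift_notMem_newChord k N g (hQ.lt hd' hi))
    · obtain ⟨d, hd, rfl⟩ := mem_image.1 hc
      obtain ⟨i, hi, rfl⟩ := mem_image.1 hv
      exact absurd hv' (shift_notMem_newChord k N g (hQ.lt hd hi))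
    · obtain ⟨d, hd, rfl⟩ := mem_image.1 hc
      obtain ⟨d', hd', rfl⟩ := mem_image.1 hc'
      obtain ⟨i, hi, rfl⟩ := mem_image.1 hv
      rw [hinj.mem_finset_image] at hv'
      rw [hQ.eq_of_mem d hd d' hd' i hi hv']

theorem newChord_notMem_image (hk : 1 ≤ k) {Q : Finset (Finset ℕ)} (hQ : IsChordSet k N Q)
    (hg : g ∈ gapVectors k N) : newChord k N g ∉ Q.image fun c => c.image (shift g) := fun h => by
  obtain ⟨c, hc, h⟩ := mem_image.1 h
  exact last_notMem_image hg (fun v hv => hQ.lt hc hv) (h ▸ last_mem_newChord hk hg)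

theorem range_shift (hg : g ∈ gapVectors k N) :
    Set.range (shift g) = {v | v ∉ newChord k N g} := by
  ext v
  rw [Set.mem_ofPred_eq]
  constructor
  · rintro ⟨i, rfl⟩ h
    rcases lt_or_ge i N with hi | hi
    · exact shift_notMem_newChord k N g hi h
    · have := (lt_iff_mem_newChord_or hg _).2 (Or.inl h)
      rw [shift_of_ge hg hi] at this
      omega
  · intro h
    rcases lt_or_ge v (N + k) with hv | hv
    · obtain ⟨i, -, hi⟩ := ((lt_iff_mem_newChord_or hg v).1 hv).resolve_left h
      exact ⟨i, hi⟩
    · exact ⟨v - k, by rw [shift_of_ge hg (by omega)]; omega⟩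

/-- The new chord is recovered as the chord that contains the last vertex; its complement is the
range of the renumbering, which determines `g`. -/
theorem insertChord_inj (hk : 1 ≤ k) {Q Q' : Finset (Finset ℕ)} {g' : ℕ → ℕ}
    (hQ : IsChordSet k N Q) (hQ' : IsChordSet k N Q') (hg : g ∈ gapVectors k N)
    (hg' : g' ∈ gapVectors k N) (h : insertChord k N Q g = insertChord k N Q' g') :
    Q = Q' ∧ g = g' := by
  have hS : newChord k N g = newChord k N g' :=
    (isChordSet_insertChord hQ' hg').eq_of_mem _ (h ▸ mem_insert_self _ _) _ (mem_insert_self _ _)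
      _ (last_mem_newChord hk hg) (last_mem_newChord hk hg')
  have hgg : g = g' := by
    refine shift_injective (((shift_strictMono g).range_inj (shift_strictMono g')).1 ?_)
    rw [range_shift hg, range_shift hg', hS]
  subst hgg
  refine ⟨?_, rfl⟩
  have h1 := congrArg (fun P => P.erase (newChord k N g)) h
  simp only [insertChord] at h1
  rw [erase_insert (newChord_notMem_image hk hQ hg), erase_insert (newChord_notMem_image hk hQ' hg)]
    at h1
  exact image_injective (image_injective (shift_strictMono g).injective) h1

/-- The renumbering is the increasing enumeration of the complement of `S` in `ℕ`. -/
theorem exists_gapVector {S : Finset ℕ} (hk : 1 ≤ k) (hS : #S = k) (hlt : ∀ v ∈ S, v < N + k)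
    (hlast : N + k - 1 ∈ S) : ∃ g ∈ gapVectors k N, newChord k N g = S := by
  have hinf : {v | v ∉ S}.Infinite := (S.finite_toSet.infinite_compl)
  obtain ⟨g, hg⟩ := exists_shift_eq (Nat.nth_strictMono hinf)
  have hmem : ∀ i, shift g i ∉ S := fun i => by
    rw [hg]
    exact Nat.nth_mem_of_infinite hinf i
  have hge : ∀ i, N ≤ i → shift g i = i + k := fun i hi => by
    have hc : Nat.count (fun v => v ∉ S) (i + k) = i := by
      rw [Nat.count_eq_card_filter_range, filter_notMem_eq_sdiff, card_sdiff_of_subset, hS,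
        card_range, Nat.add_sub_cancel]
      exact fun v hv => mem_range.2 ((hlt v hv).trans_le (by omega))
    rw [hg]
    conv_lhs => rw [← hc]
    exact Nat.nth_count fun h => by have := hlt _ h; omega
  refine ⟨g, mem_gapVectors.2 ⟨⟨?_, fun i hi => ?_⟩, ?_⟩, ?_⟩
  · have := hge N le_rfl
    rw [shift] at this
    omega
  · by_contra h
    have h1 := hge i (by omega)
    have h2 := hge (i - 1) (by omega)
    have h3 := shift_succ g (i - 1)
    rw [Nat.sub_add_cancel (by omega)] at h3
    omega
  · have h1 := hge N le_rfl
    rcases Nat.eq_zero_or_pos N with rfl | hN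
    · simp [shift] at h1
      omega
    · by_contra h
      have h3 := shift_succ g (N - 1)
      rw [Nat.sub_add_cancel (by omega)] at h3
      refine hmem (N - 1) ?_
      rwa [show shift g (N - 1) = N + k - 1 by omega]
  · ext v
    rw [newChord, mem_sdiff, mem_range, mem_image]
    constructor
    · rintro ⟨h1, h2⟩
      by_contra h
      have h3 : v ∈ Set.range (Nat.nth fun v => v ∉ S) := by
        rw [Nat.range_nth_of_infinite hinf]
        exact h
      obtain ⟨i, rfl⟩ := h3
      rw [← hg] at h1 h2
      refine h2 ⟨i, mem_range.2 ((shift_strictMono g).lt_iff_lt.1 ?_), rfl⟩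
      rwa [hge N le_rfl]
    · intro h
      refine ⟨hlt v h, ?_⟩
      rintro ⟨i, -, rfl⟩
      exact hmem i h

theorem exists_insertChord_eq (hk : 1 ≤ k) {P : Finset (Finset ℕ)} (hP : IsChordSet k (N + k) P) :
    ∃ Q, IsChordSet k N Q ∧ ∃ g ∈ gapVectors k N, insertChord k N Q g = P := by
  obtain ⟨S, hSP, hlast⟩ := (hP.lt_iff (N + k - 1)).1 (by omega)
  obtain ⟨g, hg, hS⟩ := exists_gapVector hk (hP.card_eq S hSP) (fun v hv => hP.lt hSP hv) hlast
  have hinj := (shift_strictMono g).injective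
  have himg : ∀ c ∈ P.erase S, ({i ∈ range N | shift g i ∈ c} : Finset ℕ).image (shift g) = c := by
    intro c hc
    obtain ⟨hcS, hcP⟩ := mem_erase.1 hc
    ext v
    simp only [mem_image, mem_filter, mem_range]
    constructor
    · rintro ⟨i, ⟨-, h⟩, rfl⟩
      exact h
    · intro hv
      rcases (lt_iff_mem_newChord_or hg v).1 (hP.lt hcP hv) with h | ⟨i, hi, rfl⟩
      · rw [hS] at h
        exact absurd (hP.eq_of_mem c hcP S hSP v hv h) hcS
      · exact ⟨i, ⟨hi, hv⟩, rfl⟩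
  refine ⟨(P.erase S).image fun c => {i ∈ range N | shift g i ∈ c}, ⟨fun c hc => ?_, fun v => ?_,
    fun c hc c' hc' v hv hv' => ?_⟩, g, hg, ?_⟩
  · obtain ⟨d, hd, rfl⟩ := mem_image.1 hc
    rw [← card_image_of_injective _ hinj, himg d hd, hP.card_eq d (mem_of_mem_erase hd)]
  · rw [exists_mem_image]
    simp only [mem_filter, mem_range]
    constructor
    · intro hv
      have h1 := shift_lt hg hv
      obtain ⟨c, hc, h⟩ := (hP.lt_iff (shift g v)).1 (by omega)
      refine ⟨c, mem_erase.2 ⟨?_, hc⟩, hv, h⟩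
      rintro rfl
      rw [← hS] at h
      exact shift_notMem_newChord k N g hv h
    · rintro ⟨c, -, h, -⟩
      exact h
  · obtain ⟨d, hd, rfl⟩ := mem_image.1 hc
    obtain ⟨d', hd', rfl⟩ := mem_image.1 hc'
    rw [hP.eq_of_mem d (mem_of_mem_erase hd) d' (mem_of_mem_erase hd') _ (mem_filter.1 hv).2
      (mem_filter.1 hv').2]
  · rw [insertChord, image_image, hS]
    conv_rhs => rw [← insert_erase hSP]
    congr 1
    conv_rhs => rw [← image_id (s := P.erase S)]
    exact image_congr fun c hc => himg c hc

/-! ### Short chords under insertion -/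

/-- The first vertices of the short chords of `Q`. For `1 ≤ k` these are in bijection with the short
chords. -/
def shortStarts (k N : ℕ) (Q : Finset (Finset ℕ)) : Finset ℕ := {a ∈ range N | Ico a (a + k) ∈ Q}

theorem image_shift_Ico {a : ℕ} (h : ∀ v ∈ Ico (a + 1) (a + k), g v = 0) :
    (Ico a (a + k)).image (shift g) = Ico (shift g a) (shift g a + k) := by
  have h1 : ∀ i < k, shift g (a + i) = shift g a + i := fun i hi => by
    induction i with
    | zero => rfl
    | succ i ih =>
      rw [← add_assoc, shift_succ, ih (by omega), h _ (mem_Ico.2 ⟨by omega, by omega⟩)]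
      ring
  ext v
  simp only [mem_image, mem_Ico]
  constructor
  · rintro ⟨i, ⟨h2, h3⟩, rfl⟩
    have := h1 (i - a) (by omega)
    rw [Nat.add_sub_cancel' h2] at this
    omega
  · rintro ⟨h2, h3⟩
    exact ⟨a + (v - shift g a), ⟨by omega, by omega⟩, by rw [h1 _ (by omega)]; omega⟩

/-- A chord that is short after the insertion was short before, and nothing was inserted between
its vertices. -/
theorem eq_Ico_of_image_shift_eq_Ico (hk : 1 ≤ k) {c : Finset ℕ} {b : ℕ}
    (h : c.image (shift g) = Ico b (b + k)) :
    ∃ a, c = Ico a (a + k) ∧ shift g a = b ∧ ∀ v ∈ Ico (a + 1) (a + k), g v = 0 := by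
  have hmono := shift_strictMono g
  have hex : ∀ i < k, ∃ j ∈ c, shift g j = b + i := fun i hi => by
    rw [← mem_image, h, mem_Ico]
    omega
  obtain ⟨a, hac, hab⟩ := hex 0 hk
  have h1 : ∀ i < k, a + i ∈ c ∧ shift g (a + i) = b + i := fun i hi => by
    induction i with
    | zero => exact ⟨hac, hab⟩
    | succ i ih =>
      obtain ⟨-, ih⟩ := ih (by omega)
      obtain ⟨j, hj, hjb⟩ := hex (i + 1) hi
      have h2 : a + i < j := hmono.lt_iff_lt.1 (by omega)
      have h3 := hmono.monotone (show a + i + 1 ≤ j by omega)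
      have h4 := shift_succ g (a + i)
      have h5 : j = a + (i + 1) := by
        by_contra hne
        have := hmono (show a + i + 1 < j by omega)
        omega
      exact ⟨h5 ▸ hj, h5 ▸ hjb⟩
  have h0 : ∀ v ∈ Ico (a + 1) (a + k), g v = 0 := fun v hv => by
    rw [mem_Ico] at hv
    have h2 := (h1 (v - a) (by omega)).2
    have h3 := (h1 (v - a - 1) (by omega)).2
    have h4 := shift_succ g (a + (v - a - 1))
    rw [show a + (v - a - 1) + 1 = v by omega] at h4
    rw [show a + (v - a) = v by omega] at h2
    omega
  refine ⟨a, image_injective hmono.injective ?_, hab, h0⟩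
  rw [image_shift_Ico h0, h, hab, add_zero]

theorem newChord_eq_Ico_iff (hk : 1 ≤ k) (hg : g ∈ gapVectors k N) (b : ℕ) :
    newChord k N g = Ico b (b + k) ↔ b = N ∧ g N = k := by
  have hsum := (mem_gapVectors.1 hg).1.1
  rw [sum_range_succ] at hsum
  have hiff : g N = k ↔ ∀ i < N, g i = 0 := by
    rw [← hsum, eq_comm, Nat.add_eq_right, sum_eq_zero_iff]
    simp only [mem_range]
  constructor
  · intro h
    have h1 := last_mem_newChord hk hg
    have h2 : b + k - 1 ∈ newChord k N g := by rw [h, mem_Ico]; omega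
    have h3 := (lt_iff_mem_newChord_or hg _).2 (Or.inl h2)
    rw [h, mem_Ico] at h1
    have hb : b = N := by omega
    subst hb
    refine ⟨rfl, ?_⟩
    have hlt : ∀ i < b, shift g i < b := fun i hi => by
      have h4 := shift_notMem_newChord k b g hi
      have h5 := shift_lt hg hi
      rw [h, mem_Ico] at h4
      omega
    rcases Nat.eq_zero_or_pos b with rfl | hb
    · simpa using hsum
    · have h6 := hlt (b - 1) (by omega)
      rw [shift, Nat.sub_add_cancel hb] at h6
      omega
  · rintro ⟨rfl, h⟩
    have h0 := hiff.1 h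
    have h1 : ∀ i < b, shift g i = i := fun i hi => by
      rw [shift, sum_eq_zero fun j hj => h0 j ?_, add_zero]
      rw [mem_range] at hj
      omega
    ext v
    rw [newChord, mem_sdiff, mem_range, mem_image, mem_Ico]
    constructor
    · rintro ⟨h2, h3⟩
      refine ⟨?_, h2⟩
      by_contra hv
      exact h3 ⟨v, mem_range.2 (by omega), h1 v (by omega)⟩
    · rintro ⟨h2, h3⟩
      refine ⟨h3, ?_⟩
      rintro ⟨i, hi, rfl⟩
      rw [mem_range] at hi
      rw [h1 i hi] at h2
      omega

theorem card_shortStarts_insertChord (hk : 1 ≤ k) {Q : Finset (Finset ℕ)} (hQ : IsChordSet k N Q)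
    (hg : g ∈ gapVectors k N) :
    #(shortStarts k (N + k) (insertChord k N Q g)) =
      #({a ∈ shortStarts k N Q | ∀ v ∈ Ico (a + 1) (a + k), g v = 0} : Finset ℕ) +
        if g N = k then 1 else 0 := by
  have hinj := (shift_strictMono g).injective
  have heq : shortStarts k (N + k) (insertChord k N Q g) =
      ({a ∈ shortStarts k N Q | ∀ v ∈ Ico (a + 1) (a + k), g v = 0} : Finset ℕ).image (shift g) ∪
        if g N = k then {N} else ∅ := by
    ext b
    rw [mem_union, mem_image]
    simp only [shortStarts, mem_filter, insertChord, mem_insert, mem_range]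
    have hite : (b ∈ if g N = k then ({N} : Finset ℕ) else ∅) ↔ b = N ∧ g N = k := by
      split <;> simp [*]
    rw [hite, ← newChord_eq_Ico_iff hk hg, eq_comm (a := newChord k N g)]
    constructor
    · rintro ⟨-, h | h⟩
      · exact Or.inr h
      · obtain ⟨c, hc, h⟩ := mem_image.1 h
        obtain ⟨a, rfl, hab, h0⟩ := eq_Ico_of_image_shift_eq_Ico hk h
        exact Or.inl ⟨a, ⟨⟨hQ.lt hc (mem_Ico.2 ⟨le_rfl, by omega⟩), hc⟩, h0⟩, hab⟩
    · rintro (⟨a, ⟨⟨ha, hc⟩, h0⟩, rfl⟩ | h)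
      · have := shift_lt hg ha
        exact ⟨by omega, Or.inr (mem_image.2 ⟨_, hc, image_shift_Ico h0⟩)⟩
      · refine ⟨?_, Or.inl h⟩
        have := ((newChord_eq_Ico_iff hk hg b).1 h.symm).1
        omega
  rw [heq, card_union_of_disjoint, card_image_of_injective _ hinj]
  · congr 1
    split <;> simp
  · split
    · rename_i h
      rw [disjoint_singleton_right, mem_image]
      rintro ⟨a, ha, hN⟩
      have haN := mem_range.1 (mem_filter.1 (mem_filter.1 ha).1).1
      refine shift_notMem_newChord k N g haN ?_
      rw [hN, (newChord_eq_Ico_iff hk hg N).2 ⟨rfl, h⟩, mem_Ico]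
      omega
    · exact disjoint_empty_right _

end

/-- Deleting the chord of the last vertex is a bijection from the chord sets on `N + k` vertices to
the pairs of a chord set on `N` vertices and a gap vector. -/
theorem card_chordSets_add (k N l : ℕ) (hk : 1 ≤ k) :
    #{P ∈ chordSets k (N + k) | #(shortStarts k (N + k) P) = l} =
      ∑ Q ∈ chordSets k N, #{g ∈ gapVectors k N |
        #({a ∈ shortStarts k N Q | ∀ v ∈ Ico (a + 1) (a + k), g v = 0} : Finset ℕ) +
          (if g N = k then 1 else 0) = l} := by
  rw [← card_sigma]
  refine (card_bij (fun p _ => insertChord k N p.1 p.2) ?_ ?_ ?_).symm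
  · rintro ⟨Q, g⟩ h
    simp only [mem_sigma, mem_filter, mem_chordSets] at h ⊢
    obtain ⟨hQ, hg, h⟩ := h
    exact ⟨isChordSet_insertChord hQ hg, by rw [card_shortStarts_insertChord hk hQ hg, h]⟩
  · rintro ⟨Q, g⟩ h ⟨Q', g'⟩ h' heq
    simp only [mem_sigma, mem_filter, mem_chordSets] at h h'
    obtain ⟨rfl, rfl⟩ := insertChord_inj hk h.1 h'.1 h.2.1 h'.2.1 heq
    rfl
  · intro P hP
    rw [mem_filter, mem_chordSets] at hP
    obtain ⟨Q, hQ, g, hg, rfl⟩ := exists_insertChord_eq hk hP.1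
    rw [card_shortStarts_insertChord hk hQ hg] at hP
    exact ⟨⟨Q, g⟩, by simpa only [mem_sigma, mem_filter, mem_chordSets] using ⟨hQ, hg, hP.2⟩, rfl⟩

/-! ### The recurrence for chord sets -/

/-- Fixing the last entry of a gap vector to be `h` leaves a vector on `range N` with entry sum
`k - h`. -/
theorem card_filter_gapVectors_last {k N h : ℕ} (h1 : 1 ≤ h) (hk : h ≤ k) (p : (ℕ → ℕ) → Prop)
    [DecidablePred p] (hp : ∀ g x, p (Function.update g N x) ↔ p g) :
    #{g ∈ gapVectors k N | p g ∧ g N = h} = #{g ∈ piAntidiag (range N) (k - h) | p g} := by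
  have hsum : ∀ (g : ℕ → ℕ) (x : ℕ), ∑ i ∈ range N, Function.update g N x i = ∑ i ∈ range N, g i :=
    fun g x => sum_update_of_notMem (by simp) _ _
  refine card_bij' (fun g _ => Function.update g N 0) (fun g _ => Function.update g N h) ?_ ?_ ?_ ?_
  · intro g hg
    simp only [mem_filter, mem_gapVectors, mem_piAntidiag, mem_range] at hg ⊢
    obtain ⟨⟨⟨h2, h3⟩, h4⟩, h5, h6⟩ := hg
    rw [sum_range_succ] at h2
    refine ⟨⟨by rw [hsum]; omega, fun i hi => ?_⟩, (hp _ _).2 h5⟩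
    rcases eq_or_ne i N with rfl | hne
    · simp at hi
    · rw [Function.update_of_ne hne] at hi
      have := h3 i hi
      omega
  · intro g hg
    simp only [mem_filter, mem_gapVectors, mem_piAntidiag, mem_range] at hg ⊢
    obtain ⟨⟨h2, h3⟩, h5⟩ := hg
    rw [sum_range_succ, hsum, h2, Function.update_self]
    refine ⟨⟨⟨by omega, fun i hi => ?_⟩, h1⟩, (hp _ _).2 h5, rfl⟩
    rcases eq_or_ne i N with rfl | hne
    · omega
    · rw [Function.update_of_ne hne] at hi
      have := h3 i hi
      omega
  · intro g hg
    simp only [mem_filter] at hg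
    simp [← hg.2.2]
  · intro g hg
    simp only [mem_filter, mem_piAntidiag, mem_range] at hg
    have : g N = 0 := by
      by_contra h
      exact lt_irrefl _ (hg.1.2 N h)
    rw [Function.update_idem, Function.update_eq_self_iff, this]

/-- The gap vectors are sorted by their last entry `h`. For `h = k` only the vector with no other
nonzero entry occurs, and it makes the new chord short. -/
theorem card_filter_gapVectors {k N : ℕ} (hk : 1 ≤ k) (l : ℕ) (A : Finset ℕ)
    (hA : ∀ a ∈ A, Ico (a + 1) (a + k) ⊆ range N) :
    #{g ∈ gapVectors k N | #({a ∈ A | ∀ v ∈ Ico (a + 1) (a + k), g v = 0} : Finset ℕ) +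
        (if g N = k then 1 else 0) = l} =
      (if #A + 1 = l then 1 else 0) + ∑ h ∈ Icc 1 (k - 1), #{g ∈ piAntidiag (range N) (k - h) |
        #({a ∈ A | ∀ v ∈ Ico (a + 1) (a + k), g v = 0} : Finset ℕ) = l} := by
  have hupd : ∀ (g : ℕ → ℕ) (x : ℕ),
      ({a ∈ A | ∀ v ∈ Ico (a + 1) (a + k), Function.update g N x v = 0} : Finset ℕ) =
        ({a ∈ A | ∀ v ∈ Ico (a + 1) (a + k), g v = 0} : Finset ℕ) := fun g x =>
    filter_congr fun a ha => forall₂_congr fun v hv => by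
      have := mem_range.1 (hA a ha hv)
      rw [Function.update_of_ne (by omega)]
  have hfib : ∀ g ∈ ({g ∈ gapVectors k N |
      #({a ∈ A | ∀ v ∈ Ico (a + 1) (a + k), g v = 0} : Finset ℕ) +
        (if g N = k then 1 else 0) = l} : Finset (ℕ → ℕ)), g N ∈ Icc 1 k := fun g hg => by
    have h := mem_gapVectors.1 (mem_filter.1 hg).1
    rw [sum_range_succ] at h
    rw [mem_Icc]
    omega
  rw [card_eq_sum_card_fiberwise hfib]
  have hstep : ∀ h ∈ Icc 1 k, #{g ∈ ({g ∈ gapVectors k N |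
      #({a ∈ A | ∀ v ∈ Ico (a + 1) (a + k), g v = 0} : Finset ℕ) +
        (if g N = k then 1 else 0) = l} : Finset (ℕ → ℕ)) | g N = h} =
      #{g ∈ piAntidiag (range N) (k - h) |
        #({a ∈ A | ∀ v ∈ Ico (a + 1) (a + k), g v = 0} : Finset ℕ) +
          (if h = k then 1 else 0) = l} := fun h hh => by
    rw [mem_Icc] at hh
    rw [← card_filter_gapVectors_last hh.1 hh.2 _ fun g x => by rw [hupd], filter_filter]
    congr 1
    refine filter_congr fun g _ => ?_
    constructor
    · rintro ⟨h1, rfl⟩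
      exact ⟨h1, rfl⟩
    · rintro ⟨h1, rfl⟩
      exact ⟨h1, rfl⟩
  rw [sum_congr rfl hstep, ← Nat.sub_add_cancel hk, ← insert_Icc_right_eq_Icc_add_one (by omega),
    sum_insert (by simp), Nat.sub_add_cancel hk]
  congr 1
  · rw [Nat.sub_self, piAntidiag_zero]
    simp [filter_singleton]
    split <;> simp
  · refine sum_congr rfl fun h hh => ?_
    rw [mem_Icc] at hh
    simp [show h ≠ k by omega]

theorem IsChordSet.pairwiseDisjoint {k N : ℕ} {Q : Finset (Finset ℕ)} (hQ : IsChordSet k N Q) :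
    (shortStarts k N Q : Set ℕ).PairwiseDisjoint fun a => Ico (a + 1) (a + k) := by
  intro a ha b hb hab
  refine disjoint_left.2 fun v hv hv' => hab ?_
  simp only [mem_Ico] at hv hv'
  have h := hQ.eq_of_mem _ (mem_filter.1 ha).2 _ (mem_filter.1 hb).2 v
    (mem_Ico.2 (by omega)) (mem_Ico.2 (by omega))
  have h1 : a ∈ Ico b (b + k) := h ▸ mem_Ico.2 (by omega)
  have h2 : b ∈ Ico a (a + k) := h ▸ mem_Ico.2 (by omega)
  rw [mem_Ico] at h1 h2
  omega

theorem IsChordSet.Ico_subset {k N : ℕ} {Q : Finset (Finset ℕ)} (hQ : IsChordSet k N Q) {a : ℕ}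
    (ha : a ∈ shortStarts k N Q) : Ico (a + 1) (a + k) ⊆ range N := fun v hv => by
  rw [mem_Ico] at hv
  exact mem_range.2 (hQ.lt (mem_filter.1 ha).2 (mem_Ico.2 (by omega)))

theorem IsChordSet.mul_card_shortStarts_le {k N : ℕ} {Q : Finset (Finset ℕ)}
    (hQ : IsChordSet k N Q) : (k - 1) * #(shortStarts k N Q) ≤ N := by
  have h1 : #((shortStarts k N Q).biUnion fun a => Ico (a + 1) (a + k)) ≤ #(range N) :=
    card_le_card (biUnion_subset.2 fun a ha => hQ.Ico_subset ha)
  rw [card_biUnion fun a ha b hb hab => hQ.pairwiseDisjoint ha hb hab, card_range,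
    sum_congr rfl fun a _ => show #(Ico (a + 1) (a + k)) = k - 1 by rw [Nat.card_Ico]; omega,
    sum_const, smul_eq_mul, mul_comm] at h1
  exact h1

/-- The number of ways of inserting a new chord that is not short and ends at the last position into
a diagram with `N` vertices and `m` short chords, so that exactly `l` of the short chords survive.
The summand `h` counts the insertions with `h` new vertices after all old ones. The truncated
subtractions are harmless: `(k - 1) * m ≤ N` for every diagram, and the binomial coefficient vanishes
for `m < l`. -/
noncomputable def breakWeight (k N m l : ℕ) : ℚ :=
  m.choose l * ∑ h ∈ Icc 1 (k - 1), coeff (k - h) ((invOneSubPow ℚ (N - (k - 1) * m) : ℚ⟦X⟧) *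
    ((invOneSubPow ℚ (k - 1) : ℚ⟦X⟧) - 1) ^ (m - l))

/-- The number of partitions of `{0, …, N - 1}` into `k`-element sets, `m` of which are intervals
(for `1 ≤ k`). -/
noncomputable def numChordSets (k N m : ℕ) : ℕ := #{Q ∈ chordSets k N | #(shortStarts k N Q) = m}

/-- A new chord that is not short has at most `k - 1` vertices between old ones, so it breaks at most
`k - 1` short chords. -/
theorem breakWeight_eq_zero {k N m l : ℕ} (h : ∀ p < k, m ≠ l + p) : breakWeight k N m l = 0 := by
  rcases lt_or_ge m l with hm | hm
  · rw [breakWeight, Nat.choose_eq_zero_of_lt hm, Nat.cast_zero, zero_mul]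
  · have hml : k ≤ m - l := by
      by_contra hlt
      exact h (m - l) (by omega) (by omega)
    rw [breakWeight, sum_eq_zero, mul_zero]
    intro i hi
    rw [mem_Icc] at hi
    rw [coeff_mul, sum_eq_zero]
    intro q hq
    rw [HasAntidiagonal.mem_antidiagonal] at hq
    rw [coeff_pow_eq_zero_of_lt _ _ _ (by omega), mul_zero]

/-- The first term counts the insertions of a short chord, which break no old chord; in the sum, `p`
is the number of short chords that are broken. -/
theorem numChordSets_add {k : ℕ} (N l : ℕ) (hk : 1 ≤ k) :
    (numChordSets k (N + k) l : ℚ) = #{Q ∈ chordSets k N | #(shortStarts k N Q) + 1 = l} +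
      ∑ p ∈ range k, breakWeight k N (l + p) l * numChordSets k N (l + p) := by
  have hQ : ∀ Q ∈ chordSets k N, (#{g ∈ gapVectors k N |
        #({a ∈ shortStarts k N Q | ∀ v ∈ Ico (a + 1) (a + k), g v = 0} : Finset ℕ) +
          (if g N = k then 1 else 0) = l} : ℚ) =
      (if #(shortStarts k N Q) + 1 = l then 1 else 0) +
        ∑ p ∈ range k, if #(shortStarts k N Q) = l + p then breakWeight k N (l + p) l else 0 := by
    intro Q hQ
    rw [mem_chordSets] at hQ
    rw [card_filter_gapVectors hk l _ fun a ha => hQ.Ico_subset ha]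
    push_cast
    congr 1
    have h1 : ∀ h, (#{g ∈ piAntidiag (range N) (k - h) |
        #({a ∈ shortStarts k N Q | ∀ v ∈ Ico (a + 1) (a + k), g v = 0} : Finset ℕ) = l} : ℚ) = _ :=
      fun h => card_filter_card_empty_eq (fun a => Ico (a + 1) (a + k)) (k - 1) (k - h) l
        (shortStarts k N Q) (fun a _ => by rw [Nat.card_Ico]; omega) hQ.pairwiseDisjoint (range N)
        (fun a ha => hQ.Ico_subset ha) (N - (k - 1) * #(shortStarts k N Q))
        (by rw [card_range, Nat.sub_add_cancel hQ.mul_card_shortStarts_le])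
    rw [sum_congr rfl fun h _ => h1 h, ← mul_sum, ← breakWeight]
    by_cases hm : ∃ p < k, #(shortStarts k N Q) = l + p
    · obtain ⟨p, hp, hm⟩ := hm
      rw [hm, sum_eq_single p, if_pos rfl]
      · exact fun b _ hb => if_neg (by omega)
      · exact fun h => absurd (mem_range.2 hp) h
    · push Not at hm
      rw [breakWeight_eq_zero hm, sum_eq_zero]
      exact fun p hp => if_neg (hm p (mem_range.1 hp))
  rw [numChordSets, card_chordSets_add k N l hk]
  push_cast
  rw [sum_congr rfl hQ, sum_add_distrib, sum_boole, sum_comm]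
  congr 1
  refine sum_congr rfl fun p _ => ?_
  rw [← sum_filter, sum_const, nsmul_eq_mul, mul_comm, numChordSets]

theorem mul_le_of_numChordSets_ne_zero {k N m : ℕ} (h : numChordSets k N m ≠ 0) :
    (k - 1) * m ≤ N := by
  obtain ⟨Q, hQ⟩ := card_ne_zero.1 h
  rw [mem_filter, mem_chordSets] at hQ
  rw [← hQ.2]
  exact hQ.1.mul_card_shortStarts_le

/-! ### Diagrams on `Fin (k * n)` as chord sets -/

/-- The chords of a diagram, as sets of natural numbers. -/
def chordSet {k n : ℕ} (P : Finpartition (univ : Finset (Fin (k * n)))) : Finset (Finset ℕ) :=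
  P.parts.image fun c => c.map Fin.valEmbedding

theorem chordSet_injective {k n : ℕ} : Function.Injective (chordSet (k := k) (n := n)) :=
  fun _ _ h => Finpartition.ext (image_injective (map_injective _) h)

theorem isChordSet_chordSet {k n : ℕ} {P : Finpartition (univ : Finset (Fin (k * n)))}
    (hP : IsDiagram k n P) : IsChordSet k (k * n) (chordSet P) := by
  refine ⟨fun c hc => ?_, fun v => ?_, fun c hc c' hc' v hv hv' => ?_⟩
  · obtain ⟨d, hd, rfl⟩ := mem_image.1 hc
    rw [card_map, hP d hd]
  · rw [chordSet, exists_mem_image]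
    constructor
    · intro hv
      obtain ⟨c, hc, hvc⟩ := P.exists_mem (mem_univ ⟨v, hv⟩)
      exact ⟨c, hc, mem_map_of_mem Fin.valEmbedding hvc⟩
    · rintro ⟨c, -, hv⟩
      obtain ⟨w, -, rfl⟩ := mem_map.1 hv
      exact w.2
  · obtain ⟨d, hd, rfl⟩ := mem_image.1 hc
    obtain ⟨d', hd', rfl⟩ := mem_image.1 hc'
    obtain ⟨w, hw, rfl⟩ := mem_map.1 hv
    rw [mem_map'] at hv'
    rw [P.eq_of_mem_parts hd hd' hw hv']

theorem exists_chordSet_eq {k n : ℕ} (hk : 1 ≤ k) {Q : Finset (Finset ℕ)}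
    (hQ : IsChordSet k (k * n) Q) :
    ∃ P : Finpartition (univ : Finset (Fin (k * n))), IsDiagram k n P ∧ chordSet P = Q := by
  have hmap : ∀ c ∈ Q,
      ({v | (v : ℕ) ∈ c} : Finset (Fin (k * n))).map Fin.valEmbedding = c := fun c hc => by
    ext v
    simp only [mem_map, mem_filter_univ, Fin.valEmbedding_apply]
    exact ⟨by rintro ⟨w, hw, rfl⟩; exact hw, fun hv => ⟨⟨v, hQ.lt hc hv⟩, hv, rfl⟩⟩
  have hcard : ∀ c ∈ Q, #({v | (v : ℕ) ∈ c} : Finset (Fin (k * n))) = k := fun c hc => by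
    rw [← card_map Fin.valEmbedding, hmap c hc, hQ.card_eq c hc]
  refine ⟨Finpartition.ofExistsUnique 
    (Q.image fun c => ({v | (v : ℕ) ∈ c} : Finset (Fin (k * n))))
    (fun p _ => subset_univ p) (fun v _ => ?_) ?_, ?_, ?_⟩
  · obtain ⟨c, hc, hv⟩ := (hQ.lt_iff v).1 v.2
    refine ⟨({v | (v : ℕ) ∈ c} : Finset (Fin (k * n))), ⟨mem_image_of_mem _ hc, by simpa using hv⟩, ?_⟩
    rintro d ⟨hd, hvd⟩
    obtain ⟨c', hc', rfl⟩ := mem_image.1 hd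
    rw [hQ.eq_of_mem c hc c' hc' v hv (by simpa using hvd)]
  · intro h
    obtain ⟨c, hc, h⟩ := mem_image.1 h
    have := hcard c hc
    rw [h, card_empty] at this
    omega
  · intro c hc
    obtain ⟨d, hd, rfl⟩ := mem_image.1 hc
    exact hcard d hd
  · change (Q.image _).image _ = Q
    rw [image_image]
    conv_rhs => rw [← image_id (s := Q)]
    exact image_congr fun c hc => hmap c hc

/-- The right side forces the interval to lie within the vertices; on the left this follows from
`#c = k`, since `IsShort` alone also holds for an interval cut off at the last vertex. -/
theorem isShort_iff {k n : ℕ} {c : Finset (Fin (k * n))} (hc : #c = k) :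
    IsShort c ↔ ∃ a, c.map Fin.valEmbedding = Ico a (a + k) := by
  refine exists_congr fun a => ⟨fun h => ?_, fun h v => ?_⟩
  · refine eq_of_subset_of_card_le (fun v hv => ?_) (by rw [card_map, hc, Nat.card_Ico]; omega)
    obtain ⟨w, hw, rfl⟩ := mem_map.1 hv
    exact mem_Ico.2 ((h w).1 hw)
  · rw [← mem_Ico, ← h]
    exact (mem_map' Fin.valEmbedding).symm

theorem numShort_eq {k n : ℕ} (hk : 1 ≤ k) {P : Finpartition (univ : Finset (Fin (k * n)))}
    (hP : IsDiagram k n P) : numShort P = #(shortStarts k (k * n) (chordSet P)) := by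
  have hinj : Function.Injective fun a => Ico a (a + k) := fun a b h => by
    dsimp only at h
    have h1 : a ∈ Ico b (b + k) := h ▸ mem_Ico.2 (by omega)
    have h2 : b ∈ Ico a (a + k) := h ▸ mem_Ico.2 (by omega)
    rw [mem_Ico] at h1 h2
    omega
  rw [numShort, ← Set.ncard_image_of_injective _ (map_injective Fin.valEmbedding),
    ← card_image_of_injective _ hinj, ← Set.ncard_coe_finset]
  congr 1
  ext c
  simp only [Set.mem_image, Set.mem_ofPred_eq, coe_image, mem_coe, shortStarts, mem_filter]
  constructor
  · rintro ⟨c, ⟨hc, hs⟩, rfl⟩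
    obtain ⟨a, ha⟩ := (isShort_iff (hP c hc)).1 hs
    have hmem : Ico a (a + k) ∈ chordSet P := ha ▸ mem_image_of_mem _ hc
    exact ⟨a, ⟨mem_range.2 ((isChordSet_chordSet hP).lt hmem (mem_Ico.2 (by omega))), hmem⟩, ha.symm⟩
  · rintro ⟨a, ⟨-, ha⟩, rfl⟩
    obtain ⟨c, hc, h⟩ := mem_image.1 ha
    exact ⟨c, ⟨hc, (isShort_iff (hP c hc)).2 ⟨a, h⟩⟩, h⟩

theorem d_eq_numChordSets {k : ℕ} (hk : 1 ≤ k) (n l : ℕ) : d k n l = numChordSets k (k * n) l := by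
  rw [d, numChordSets, ← Set.ncard_coe_finset, ← Set.ncard_image_of_injective _ chordSet_injective]
  congr 1
  ext Q
  simp only [Set.mem_image, Set.mem_ofPred_eq, mem_coe, mem_filter, mem_chordSets, Nat.cast_inj]
  constructor
  · rintro ⟨P, ⟨hP, hl⟩, rfl⟩
    exact ⟨isChordSet_chordSet hP, by rw [← numShort_eq hk hP, hl]⟩
  · rintro ⟨hQ, hl⟩
    obtain ⟨P, hP, rfl⟩ := exists_chordSet_eq hk hQ
    exact ⟨P, ⟨hP, by rw [numShort_eq hk hP, hl]⟩, rfl⟩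

theorem d_sub_one {k : ℕ} (hk : 1 ≤ k) (n l : ℕ) :
    d k n ((l : ℤ) - 1) = #{Q ∈ chordSets k (k * n) | #(shortStarts k (k * n) Q) + 1 = l} := by
  cases l with
  | zero =>
    rw [filter_false_of_mem (by simp), card_empty, d]
    refine (congrArg Set.ncard (Set.eq_empty_of_forall_notMem fun P hP => ?_)).trans
      (Set.ncard_empty _)
    have := hP.2
    omega
  | succ l =>
    rw [show ((l + 1 : ℕ) : ℤ) - 1 = l by push_cast; ring, d_eq_numChordSets hk, numChordSets]
    simp

end KChord

theorem theorem12 (k n ℓ : ℕ) (hk : 1 ≤ k) :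
    (KChord.d k (n + 1) ℓ : ℚ) =
      KChord.d k n ((ℓ : ℤ) - 1) +
      KChord.d k n ℓ * ∑ h ∈ Finset.Icc 1 (k - 1),
        ((Ring.choose ((k : ℤ) * n - ((k : ℤ) - 1) * ℓ + k - h - 1) (k - h) : ℤ) : ℚ) +
      ∑ p ∈ Finset.Icc 1 (k - 1), KChord.C n ℓ p k * KChord.d k n ((ℓ : ℤ) + p) := by
  open KChord Finset in
  have hrange : range k = insert 0 (Icc 1 (k - 1)) := by
    ext p
    simp only [mem_range, mem_insert, mem_Icc]
    omega
  rw [d_eq_numChordSets hk, mul_add, mul_one, numChordSets_add _ _ hk, ← d_sub_one hk, add_assoc,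
    hrange, sum_insert (by simp)]
  congr 2
  · rw [add_zero, d_eq_numChordSets hk, mul_comm]
    by_cases h0 : numChordSets k (k * n) ℓ = 0
    · rw [h0, Nat.cast_zero, zero_mul, zero_mul]
    · have hle := mul_le_of_numChordSets_ne_zero h0
      rw [breakWeight, Nat.choose_self, Nat.cast_one, one_mul]
      congr 1
      refine sum_congr rfl fun h hh => ?_
      rw [mem_Icc] at hh
      rw [Nat.sub_self, pow_zero, mul_one, ← ringChoose_eq]
      congr 2
      push_cast [hle, hk, show h ≤ k by omega]
      ring
  · refine sum_congr rfl fun p hp => ?_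
    rw [mem_Icc] at hp
    rw [← Nat.cast_add, d_eq_numChordSets hk]
    by_cases h0 : numChordSets k (k * n) (ℓ + p) = 0
    · rw [h0, Nat.cast_zero, mul_zero, mul_zero]
    · have hle := mul_le_of_numChordSets_ne_zero h0
      rw [C_eq n ℓ p k _ hk hp.1 (Nat.sub_add_cancel hle).symm, breakWeight,
        Nat.add_sub_cancel_left]
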